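/- Let $1\le d<n$ be integers, $\bm A\in\mathbb R^{d\times(n-d)}$, $\bm\alpha_0\in\mathbb R^{n-d}$ (a row vector), let $\widetilde{\bm A}=\binom{\bm\alpha_0}{\bm A}\in\mathbb R^{(d+1)\times(n-d)}$, and consider the $d$-dimensional affine subspace $$\mathscr H=\{(\bm x,\ (1,\bm x)\cdot\widetilde{\bm A}) : \bm x\in\mathbb R^d\}\subset\mathbb R^n .$$ For $y\in\mathbb R$ let $\|y\|$ be the distance from $y$ to the nearest integer, and for $\bm y\in\mathbb R^n$ put $\|\bm y\|=\max_{1\le k\le n}\|y_k\|$. For a function $\psi:\{1,2,3,\dots\}\to[0,\infty)$ (an approximation function) let $$\mathscr S_n(\psi)=\{\bm x\in\mathbb R^n : \|q\bm x\|<\psi(q)\text{ for infinitely many integers } q\ge 1\}.$$ For a matrix $\bm M\in\mathbb R^{l\times k}$ let the (multiplicative) diophantine type $\omega(\bm M)\in[-\infty,\infty]$ be the least upper bound of all real $\omega$ for which $$\prod_{u=1}^{l}\|\bm j\cdot\mathrm{row}_u(\bm M)\|<|\bm j|^{-\omega}$$ has infinitely many solutions $\bm j\in\mathbb Z^{k}$,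 where $|\bm j|$ is the supremum norm of $\bm j$. Let $|\cdot|_{\mathscr H}$ be the Lebesgue measure on $\mathscr H$ induced from $\mathbb R^n$ (the $d$-dimensional Euclidean volume on $\mathscr H$). Then: (a) If $\omega(\bm A)<dn$, then $\mathscr H$ is of strong Khintchine type for convergence: for every approximation function $\psi$ such that $\sum_{q=1}^\infty\psi(q)^n$ converges, $|\mathscr H\cap\mathscr S_n(\psi)|_{\mathscr H}=0$. (b) If $\omega(\widetilde{\bm A})<(d+1)n$, then $\mathscr H$ is of Khintchine type for convergence: for every non-increasing approximation function $\psi$ such that $\sum_{q=1}^\infty\psi(q)^n$ converges, $|\mathscr H\cap\mathscr S_n(\psi)|_{\mathscr H}=0$. -/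

import Mathlib

open MeasureTheory
open scoped NNReal

noncomputable section

/-- The distance `‖y‖` of a real number `y` to the nearest integer. -/
def distInt (y : ℝ) : ℝ := |y - (round y : ℝ)|

/-- For a real vector `y`, the maximum over the coordinates of the distance to the nearest integer
(the norm on `Fin n → ℝ` is the supremum norm). -/
def distIntVec {n : ℕ} (y : Fin n → ℝ) : ℝ := ‖fun k => distInt (y k)‖

/-- The set `𝒮_n(ψ)` of simultaneously `ψ`-approximable points of Euclidean space `ℝⁿ`. The domain
`ℕ+` of an approximation function is the set of positive integers. -/
def simulApprox (n : ℕ) (ψ : ℕ+ → ℝ≥0) : Set (EuclideanSpace ℝ (Fin n)) :=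
  {x | {q : ℕ+ | distIntVec (fun k => (q : ℝ) * x k) < ψ q}.Infinite}

/-- A `d`-dimensional submanifold `M` of `ℝⁿ` is of strong Khintchine type for convergence: for
every approximation function `ψ` with `∑ ψ(q)ⁿ < ∞`, the set of `ψ`-approximable points on `M` has
measure zero. The induced Lebesgue measure on `M` is the restriction to `M` of the `d`-dimensional
Hausdorff measure of the Euclidean metric, normalised to be Lebesgue measure on `d`-dimensional
Euclidean space. -/
def IsStrongKhintchineTypeConv {n : ℕ} (d : ℕ) (M : Set (EuclideanSpace ℝ (Fin n))) : Prop :=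
  ∀ ψ : ℕ+ → ℝ≥0, Summable (fun q : ℕ+ => ψ q ^ n) →
    (μHE[d] : Measure (EuclideanSpace ℝ (Fin n))) (M ∩ simulApprox n ψ) = 0

/-- A `d`-dimensional submanifold `M` of `ℝⁿ` is of Khintchine type for convergence: the same
property, for non-increasing approximation functions only. -/
def IsKhintchineTypeConv {n : ℕ} (d : ℕ) (M : Set (EuclideanSpace ℝ (Fin n))) : Prop :=
  ∀ ψ : ℕ+ → ℝ≥0, Antitone ψ → Summable (fun q : ℕ+ => ψ q ^ n) →
    (μHE[d] : Measure (EuclideanSpace ℝ (Fin n))) (M ∩ simulApprox n ψ) = 0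

/-- The (multiplicative) diophantine type `ω(M)` of a real matrix `M`: the least upper bound, in the
extended reals, of all real `ω` such that `∏ᵤ ‖j · rowᵤ(M)‖ < |j| ^ (-ω)` for infinitely many
integer vectors `j` (here `‖j‖` is the supremum norm of `j`). -/
def diophType {l m : ℕ} (M : Matrix (Fin l) (Fin m) ℝ) : EReal :=
  sSup ((fun ω : ℝ => (ω : EReal)) ''
    {ω : ℝ | {j : Fin m → ℤ | ∏ u, distInt (∑ v, (j v : ℝ) * M u v) < ‖j‖ ^ (-ω)}.Infinite})

/-- The matrix `Ã` with `d + 1` rows, whose first row is `α₀`, followed by the rows of `A`. -/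
def extMatrix {d m : ℕ} (α₀ : Fin m → ℝ) (A : Matrix (Fin d) (Fin m) ℝ) :
    Matrix (Fin (d + 1)) (Fin m) ℝ :=
  Matrix.of (Fin.cons α₀ A : Fin (d + 1) → Fin m → ℝ)

/-- The affine subspace `ℋ = {(x, x̃ · Ã) : x ∈ ℝᵈ}` of `ℝᵈ⁺ᵐ`, where `x̃ = (1, x)` and `B` plays
the role of `Ã`. -/
def affineGraph {d m : ℕ} (B : Matrix (Fin (d + 1)) (Fin m) ℝ) :
    Set (EuclideanSpace ℝ (Fin (d + m))) :=
  Set.range fun x : Fin d → ℝ =>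
    WithLp.toLp 2 (Fin.append x (Matrix.vecMul (Fin.cons 1 x : Fin (d + 1) → ℝ) B))

end

/-! By Borel–Cantelli, everything rests on counting integer vectors `a` in a box of side `H` for
which `β + aM` is within `δ` of an integer vector. The expected order is `H^l * δ^m`, and
`exists_card_le` proves this as an upper bound for `δ ≥ H^(-τ)` whenever `τ * ω < l`.

The count is Fourier analytic (`exists_card_mul_le`). Detecting closeness by squared exponential
sums of length `J ≈ 1/(6δ)` and summing over `a` leaves products of geometric sums at `h ·
row_u(M)`, where `h` is a difference of two frequencies. The diophantine type bounds `∏ ‖h ·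
row_u(M)‖` below by `η = c * J^(-ω)` for every `h ≠ 0`. Since differences of frequencies are again
such `h`, the points formed by these linear forms modulo 1 are multiplicatively separated. Each
dyadic box therefore holds few of them, and their inverse products sum to only about `η^(-1-ε)`.

Replacing `ψ` by `max ψ q^(-τ)` keeps `δ` in the admissible range and costs nothing if `τ * n > 1`.
A suitable `τ` exists precisely when `ω < l * n`. Part (a) fixes `q` and takes `M = A`, `β = q *
α₀`, `l = d`. Part (b) counts `(q, p)` jointly over dyadic blocks of `q`, with `M = Ã`, `β = 0`, `l
= d + 1`. -/

/-! ### Multiplicatively separated points and sums of inverse products. -/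

/-- A set of points in a box whose coordinate differences have product at least `η` has
cardinality bounded by the volume of the box divided by `η`, up to constants. -/
theorem card_le_of_prod_abs_sub_ge {ι : Type*} {l : ℕ} (S : Finset ι) (y : ι → Fin (l + 1) → ℝ)
    (η : ℝ) (hη : 0 < η) (b : Fin (l + 1) → ℝ) (hb : ∀ u, 0 < b u)
    (hy : ∀ i ∈ S, ∀ u, |y i u| ≤ b u)
    (hsep : ∀ i ∈ S, ∀ i' ∈ S, i ≠ i' → η ≤ ∏ u, |y i u - y i' u|) :
    (S.card : ℝ) ≤ 2 ^ (l + 1) * (∏ u, b u) / η + 2 := by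
  set P : ℝ := ∏ u : Fin l, (2 * b u.succ) with hP
  have hPpos : 0 < P := Finset.prod_pos fun u _ => by have := hb u.succ; positivity
  -- All differences in the other coordinates are at most `2 * b u`, so separation forces a gap of
  -- at least `t` in coordinate 0; then pigeonhole on cells of length `t`.
  set t : ℝ := η / P with ht
  have htpos : 0 < t := by positivity
  have hsep0 : ∀ i ∈ S, ∀ i' ∈ S, i ≠ i' → t ≤ |y i 0 - y i' 0| := by
    intro i hi i' hi' hne
    have h := hsep i hi i' hi' hne
    rw [Fin.prod_univ_succ] at h
    rw [ht, div_le_iff₀ hPpos]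
    refine h.trans (mul_le_mul_of_nonneg_left ?_ (abs_nonneg _))
    refine Finset.prod_le_prod (fun _ _ => abs_nonneg _) fun u _ => ?_
    have h1 := hy i hi u.succ
    have h2 := hy i' hi' u.succ
    have := abs_sub (y i u.succ) (y i' u.succ)
    linarith
  have hcard : S.card ≤ (Finset.Icc ⌊-b 0 / t⌋ ⌊b 0 / t⌋).card := by
    refine Finset.card_le_card_of_injOn (fun i => ⌊y i 0 / t⌋) ?_ ?_
    · intro i hi
      have h := abs_le.1 (hy i hi 0)
      simp only [Finset.coe_Icc, Set.mem_Icc]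
      exact ⟨Int.floor_le_floor (by gcongr; exact h.1), Int.floor_le_floor (by gcongr; exact h.2)⟩
    · intro i hi i' hi' hf
      by_contra hne
      have h1 := Int.abs_sub_lt_one_of_floor_eq_floor hf
      rw [← sub_div, abs_div, abs_of_pos htpos, div_lt_one htpos] at h1
      exact absurd (hsep0 i hi i' hi' hne) (not_le.2 h1)
  rw [Int.card_Icc] at hcard
  have hb0 := hb 0
  have hle : ⌊-b 0 / t⌋ ≤ ⌊b 0 / t⌋ :=
    Int.floor_le_floor (by gcongr; linarith)
  have hc : (S.card : ℝ) ≤ (⌊b 0 / t⌋ : ℝ) + 1 - ⌊-b 0 / t⌋ := by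
    have : (S.card : ℤ) ≤ ⌊b 0 / t⌋ + 1 - ⌊-b 0 / t⌋ := by omega
    exact_mod_cast this
  have h1 := Int.floor_le (b 0 / t)
  have h2 := Int.lt_floor_add_one (-b 0 / t)
  have h3 : 2 * (b 0 / t) = 2 ^ (l + 1) * (∏ u, b u) / η := by
    rw [ht, hP, Fin.prod_univ_succ, Finset.prod_mul_distrib]
    simp only [Finset.prod_const, Finset.card_univ, Fintype.card_fin]
    field_simp
    ring
  rw [neg_div] at h2 hc
  linarith

/-- Dyadic decomposition of a sum of inverse products over a set of separated points. -/
theorem sum_prod_inv_le_of_prod_abs_sub_ge {ι : Type*} {l : ℕ} (S : Finset ι)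
    (y : ι → Fin (l + 1) → ℝ) (η : ℝ) (hη : 0 < η)
    (hy : ∀ i ∈ S, ∀ u, |y i u| ≤ 1) (hprod : ∀ i ∈ S, η ≤ ∏ u, |y i u|)
    (hsep : ∀ i ∈ S, ∀ i' ∈ S, i ≠ i' → η ≤ ∏ u, |y i u - y i' u|) :
    ∑ i ∈ S, ∏ u, |y i u|⁻¹ ≤
      (Nat.log 2 ⌊η⁻¹⌋₊ + 1 : ℝ) ^ (l + 1) * (2 ^ (l + 1) * (2 ^ (l + 1) + 2) / η) := by
  classical
  have hpos : ∀ i ∈ S, ∀ u, 0 < |y i u| := by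
    intro i hi u
    rcases (abs_nonneg (y i u)).eq_or_lt with h | h
    · have := hprod i hi
      rw [Finset.prod_eq_zero (Finset.mem_univ u) h.symm] at this
      linarith
    · exact h
  have hge : ∀ i ∈ S, ∀ u, η ≤ |y i u| := by
    intro i hi u
    refine (hprod i hi).trans ?_
    rw [← Finset.mul_prod_erase _ _ (Finset.mem_univ u)]
    exact mul_le_of_le_one_right (abs_nonneg _)
      (Finset.prod_le_one (fun _ _ => abs_nonneg _) fun v _ => hy i hi v)
  have hex : ∀ i u, ∃ k : ℕ, i ∈ S →
      ((1 / 2 : ℝ) ^ (k + 1) < |y i u| ∧ |y i u| ≤ (1 / 2 : ℝ) ^ k) := by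
    intro i u
    by_cases hi : i ∈ S
    · obtain ⟨k, hk⟩ := exists_nat_pow_near_of_lt_one (hpos i hi u) (hy i hi u)
        (by norm_num : (0 : ℝ) < 1 / 2) (by norm_num)
      exact ⟨k, fun _ => hk⟩
    · exact ⟨0, fun h => absurd h hi⟩
  choose k hk using hex
  set L := Nat.log 2 ⌊η⁻¹⌋₊ with hL
  -- No coordinate is smaller than `η`, so only `(L + 1)^(l + 1)` dyadic classes occur.
  have hkL : ∀ i ∈ S, ∀ u, k i u ≤ L := by
    intro i hi u
    have h1 : η ≤ (1 / 2 : ℝ) ^ (k i u) := (hge i hi u).trans (hk i u hi).2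
    have h2 : (2 : ℝ) ^ (k i u) ≤ η⁻¹ := by
      rw [le_inv_comm₀ (by positivity) hη]
      simpa using h1
    apply Nat.le_log_of_pow_le (by norm_num)
    apply Nat.le_floor
    exact_mod_cast h2
  have hmaps : ∀ i ∈ S, k i ∈ Fintype.piFinset fun _ : Fin (l + 1) => Finset.range (L + 1) := by
    intro i hi
    rw [Fintype.mem_piFinset]
    intro u
    have := hkL i hi u
    simp only [Finset.mem_range]
    omega
  rw [← Finset.sum_fiberwise_of_maps_to hmaps]
  have hfib : ∀ κ ∈ Fintype.piFinset fun _ : Fin (l + 1) => Finset.range (L + 1),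
      ∑ i ∈ S with k i = κ, ∏ u, |y i u|⁻¹ ≤ 2 ^ (l + 1) * (2 ^ (l + 1) + 2) / η := by
    intro κ _
    set T := S.filter fun i => k i = κ with hT
    rcases T.eq_empty_or_nonempty with h0 | ⟨i₀, hi₀⟩
    · rw [h0, Finset.sum_empty]; positivity
    have hTS : ∀ i ∈ T, i ∈ S ∧ k i = κ := fun i hi => by simpa [hT] using hi
    set B : ℝ := ∏ u, (1 / 2 : ℝ) ^ (κ u) with hB
    have hBpos : 0 < B := Finset.prod_pos fun u _ => by positivity
    -- In a nonempty class the volume term dominates, which absorbs the additive 2 of the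
    -- cardinality bound.
    have hηB : η ≤ B := by
      obtain ⟨hi, hki⟩ := hTS i₀ hi₀
      refine (hprod i₀ hi).trans (Finset.prod_le_prod (fun _ _ => abs_nonneg _) fun u _ => ?_)
      rw [← hki]; exact (hk i₀ u hi).2
    have hcard := card_le_of_prod_abs_sub_ge T y η hη (fun u => (1 / 2 : ℝ) ^ (κ u))
      (fun u => by positivity)
      (fun i hi u => by obtain ⟨h1, h2⟩ := hTS i hi; rw [← h2]; exact (hk i u h1).2)
      (fun i hi i' hi' => hsep i (hTS i hi).1 i' (hTS i' hi').1)
    have hterm : ∀ i ∈ T, ∏ u, |y i u|⁻¹ ≤ 2 ^ (l + 1) / B := by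
      intro i hi
      obtain ⟨h1, h2⟩ := hTS i hi
      have : (2 : ℝ) ^ (l + 1) / B = ∏ u, ((1 / 2 : ℝ) ^ (κ u + 1))⁻¹ := by
        rw [hB, Finset.prod_inv_distrib]
        simp only [pow_succ, Finset.prod_mul_distrib, Finset.prod_const, Finset.card_univ,
          Fintype.card_fin]
        field_simp
        rw [← mul_pow]; norm_num
      rw [this]
      refine Finset.prod_le_prod (fun _ _ => by positivity) fun u _ => ?_
      rw [← h2]
      exact inv_anti₀ (by positivity) (hk i u h1).1.le
    calc ∑ i ∈ T, ∏ u, |y i u|⁻¹ ≤ T.card * (2 ^ (l + 1) / B) := by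
          have := Finset.sum_le_card_nsmul T _ _ hterm
          rwa [nsmul_eq_mul] at this
      _ ≤ ((2 ^ (l + 1) + 2) * B / η) * (2 ^ (l + 1) / B) := by
          gcongr
          refine hcard.trans ?_
          have : 1 ≤ B / η := by rwa [one_le_div hη]
          calc 2 ^ (l + 1) * B / η + 2 ≤ 2 ^ (l + 1) * B / η + 2 * (B / η) := by linarith
            _ = _ := by ring
      _ = _ := by field_simp
  refine (Finset.sum_le_card_nsmul _ _ _ hfib).trans ?_
  rw [Fintype.card_piFinset]
  simp

/-- The previous bound with the logarithms absorbed into a small power of `η`. -/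
theorem exists_sum_prod_inv_le (l : ℕ) (ε : ℝ) (hε : 0 < ε) :
    ∃ C : ℝ, 0 < C ∧ ∀ (ι : Type) (S : Finset ι) (y : ι → Fin (l + 1) → ℝ) (η : ℝ), 0 < η →
      η ≤ 1 → (∀ i ∈ S, ∀ u, |y i u| ≤ 1) → (∀ i ∈ S, η ≤ ∏ u, |y i u|) →
      (∀ i ∈ S, ∀ i' ∈ S, i ≠ i' → η ≤ ∏ u, |y i u - y i' u|) →
      ∑ i ∈ S, ∏ u, |y i u|⁻¹ ≤ C * η⁻¹ ^ (1 + ε) := by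
  -- Each of the `l + 1` logarithms may cost `η⁻¹ ^ ε'`.
  set ε' : ℝ := ε / (l + 1) with hε'
  have hε'pos : 0 < ε' := by positivity
  set D : ℝ := 1 / (ε' * Real.log 2) + 1 with hD
  have hlog2 : 0 < Real.log 2 := Real.log_pos (by norm_num)
  have hDpos : 0 < D := by positivity
  refine ⟨D ^ (l + 1) * (2 ^ (l + 1) * (2 ^ (l + 1) + 2)), by positivity, ?_⟩
  intro ι S y η hη hη1 hy hprod hsep
  refine (sum_prod_inv_le_of_prod_abs_sub_ge S y η hη hy hprod hsep).trans ?_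
  have hX : 1 ≤ η⁻¹ := (one_le_inv₀ hη).2 hη1
  have hXpos : 0 < η⁻¹ := by positivity
  set X := η⁻¹ with hXdef
  have h1 : (Nat.log 2 ⌊X⌋₊ : ℝ) ≤ Real.log X / Real.log 2 := by
    rw [le_div_iff₀ hlog2, ← Real.log_pow]
    apply Real.log_le_log (by positivity)
    have h := Nat.pow_log_le_self 2 (x := ⌊X⌋₊) (Nat.floor_pos.2 hX).ne'
    calc (2 : ℝ) ^ (Nat.log 2 ⌊X⌋₊) ≤ (⌊X⌋₊ : ℝ) := by exact_mod_cast h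
      _ ≤ X := Nat.floor_le hXpos.le
  have h2 : Real.log X / Real.log 2 ≤ X ^ ε' * (1 / (ε' * Real.log 2)) := by
    rw [div_le_iff₀ hlog2]
    refine (Real.log_le_rpow_div hXpos.le hε'pos).trans (le_of_eq ?_)
    field_simp
  have h3 : (1 : ℝ) ≤ X ^ ε' := Real.one_le_rpow hX hε'pos.le
  have h4 : (Nat.log 2 ⌊X⌋₊ + 1 : ℝ) ≤ X ^ ε' * D := by
    rw [hD]; linarith
  have h5 : (X ^ ε') ^ (l + 1) = X ^ ε := by
    rw [← Real.rpow_natCast, ← Real.rpow_mul hXpos.le]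
    congr 1
    push_cast
    rw [hε']; field_simp
  calc (Nat.log 2 ⌊X⌋₊ + 1 : ℝ) ^ (l + 1) * (2 ^ (l + 1) * (2 ^ (l + 1) + 2) / η)
      ≤ (X ^ ε' * D) ^ (l + 1) * (2 ^ (l + 1) * (2 ^ (l + 1) + 2) / η) := by gcongr
    _ = D ^ (l + 1) * (2 ^ (l + 1) * (2 ^ (l + 1) + 2)) * (X * X ^ ε) := by
        rw [mul_pow, h5, hXdef]; ring
    _ = _ := by rw [Real.rpow_add hXpos, Real.rpow_one]

/-! ### Distance to the nearest integer and additive characters. -/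

theorem distInt_nonneg (y : ℝ) : 0 ≤ distInt y := abs_nonneg _

theorem distInt_le_half (y : ℝ) : distInt y ≤ 1 / 2 := abs_sub_round y

theorem distInt_le_abs_sub_intCast (y : ℝ) (z : ℤ) : distInt y ≤ |y - z| := round_le y z

theorem distInt_le_distInt_add (x y : ℝ) : distInt x ≤ distInt y + |x - y| := by
  have h1 := distInt_le_abs_sub_intCast x (round y)
  have h2 := abs_sub_le x y (round y)
  unfold distInt at *
  linarith

/-- The additive character `x ↦ exp(2πix)`. -/
noncomputable def expTwoPi (x : ℝ) : ℂ := Complex.exp (((2 * Real.pi * x : ℝ) : ℂ) * Complex.I)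

theorem expTwoPi_add (x y : ℝ) : expTwoPi (x + y) = expTwoPi x * expTwoPi y := by
  unfold expTwoPi
  rw [← Complex.exp_add]; congr 1; push_cast; ring

theorem expTwoPi_zero : expTwoPi 0 = 1 := by simp [expTwoPi]

theorem norm_expTwoPi (x : ℝ) : ‖expTwoPi x‖ = 1 := Complex.norm_exp_ofReal_mul_I _

theorem conj_expTwoPi (x : ℝ) : (starRingEnd ℂ) (expTwoPi x) = expTwoPi (-x) := by
  unfold expTwoPi
  rw [← Complex.exp_conj, map_mul, Complex.conj_ofReal, Complex.conj_I]; congr 1; push_cast; ring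

theorem expTwoPi_sum {ι : Type*} (s : Finset ι) (f : ι → ℝ) :
    expTwoPi (∑ i ∈ s, f i) = ∏ i ∈ s, expTwoPi (f i) := by
  classical
  induction s using Finset.induction_on with
  | empty => simp [expTwoPi_zero]
  | insert a s ha ih => rw [Finset.sum_insert ha, Finset.prod_insert ha, expTwoPi_add, ih]

theorem expTwoPi_nat_mul (k : ℕ) (x : ℝ) : expTwoPi (k * x) = expTwoPi x ^ k := by
  unfold expTwoPi
  rw [← Complex.exp_nat_mul]; congr 1; push_cast; ring

theorem expTwoPi_intCast (z : ℤ) : expTwoPi z = 1 := by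
  unfold expTwoPi
  rw [Complex.exp_eq_one_iff]
  exact ⟨z, by push_cast; ring⟩

theorem expTwoPi_sub_intCast (x : ℝ) (z : ℤ) : expTwoPi (x - z) = expTwoPi x := by
  have := expTwoPi_add (x - z) z
  rw [expTwoPi_intCast, mul_one, sub_add_cancel] at this
  exact this.symm

/-- The chord has length `2 * |sin (π t)|`, and Jordan's inequality applies since `|t| ≤ 1/2`. -/
theorem four_mul_distInt_le_norm_expTwoPi_sub_one (x : ℝ) :
    4 * distInt x ≤ ‖expTwoPi x - 1‖ := by
  have hpi := Real.pi_pos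
  have hd := distInt_le_half x
  rw [← expTwoPi_sub_intCast x (round x)]
  unfold distInt at *
  set t := x - round x
  unfold expTwoPi
  rw [mul_comm _ Complex.I, Complex.norm_exp_I_mul_ofReal_sub_one, norm_mul]
  have h : |2 * Real.pi * t / 2| ≤ Real.pi / 2 := by
    rw [show 2 * Real.pi * t / 2 = Real.pi * t by ring, abs_mul, abs_of_pos hpi]
    nlinarith
  have := Real.mul_abs_le_abs_sin h
  rw [show |2 * Real.pi * t / 2| = Real.pi * |t| by
    rw [show 2 * Real.pi * t / 2 = Real.pi * t by ring, abs_mul, abs_of_pos hpi]] at this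
  rw [Real.norm_eq_abs, Real.norm_eq_abs, abs_two]
  have h2 : 2 / Real.pi * (Real.pi * |t|) = 2 * |t| := by field_simp
  linarith

/-- A sixth of a turn is the angle `π/3`, with cosine `1/2`; this is the source of the condition `J
* δ ≤ 1/6`. -/
theorem half_le_re_expTwoPi {x : ℝ} (hx : |x| ≤ 1 / 6) : 1 / 2 ≤ (expTwoPi x).re := by
  unfold expTwoPi
  rw [Complex.exp_ofReal_mul_I_re, ← Real.cos_abs, ← Real.cos_pi_div_three]
  have hpi := Real.pi_pos
  have h : |2 * Real.pi * x| ≤ Real.pi / 3 := by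
    rw [abs_mul, abs_of_pos (by positivity : 0 < 2 * Real.pi)]
    nlinarith
  exact Real.cos_le_cos_of_nonneg_of_le_pi (abs_nonneg _) (by linarith) h

theorem sum_Icc_int_eq_sum_range {E : Type*} [AddCommMonoid E] (a b : ℤ) (f : ℤ → E) :
    ∑ x ∈ Finset.Icc a b, f x = ∑ i ∈ Finset.range (b + 1 - a).toNat, f (i + a) := by
  rw [show Finset.Icc a b = (Finset.range (b + 1 - a).toNat).map
    (Nat.castEmbedding.trans (addLeftEmbedding a)) from rfl, Finset.sum_map]
  simp [add_comm]

/-- The geometric sum bound. -/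
theorem norm_sum_expTwoPi_mul_distInt_le (a b : ℤ) (x : ℝ) :
    ‖∑ p ∈ Finset.Icc a b, expTwoPi (p * x)‖ * distInt x ≤ 1 := by
  rw [sum_Icc_int_eq_sum_range]
  set N := (b + 1 - a).toNat
  have h1 : ∑ i ∈ Finset.range N, expTwoPi (((i + a : ℤ) : ℝ) * x)
      = (∑ i ∈ Finset.range N, expTwoPi x ^ i) * expTwoPi (a * x) := by
    rw [Finset.sum_mul]
    refine Finset.sum_congr rfl fun i _ => ?_
    rw [← expTwoPi_nat_mul, ← expTwoPi_add]; congr 1; push_cast; ring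
  rw [h1, norm_mul, norm_expTwoPi, mul_one]
  have h2 := geom_sum_mul (expTwoPi x) N
  have h3 : ‖∑ i ∈ Finset.range N, expTwoPi x ^ i‖ * ‖expTwoPi x - 1‖ ≤ 2 := by
    rw [← norm_mul, h2]
    refine (norm_sub_le _ _).trans ?_
    rw [norm_pow, norm_expTwoPi, norm_one]; norm_num
  have h4 := four_mul_distInt_le_norm_expTwoPi_sub_one x
  have h5 := norm_nonneg (∑ i ∈ Finset.range N, expTwoPi x ^ i)
  nlinarith

theorem norm_sum_expTwoPi_le_card (s : Finset ℤ) (x : ℝ) :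
    ‖∑ p ∈ s, expTwoPi (p * x)‖ ≤ s.card := by
  refine (norm_sum_le _ _).trans ?_
  simp [norm_expTwoPi]

/-- The exponential sum of length `J` is large near the integers. -/
theorem half_mul_le_norm_sum_expTwoPi {J : ℕ} {δ y : ℝ} (hJ : J * δ ≤ 1 / 6)
    (hy : distInt y ≤ δ) : (J : ℝ) / 2 ≤ ‖∑ j ∈ Finset.range J, expTwoPi (j * y)‖ := by
  have hδ : 0 ≤ δ := (distInt_nonneg y).trans hy
  have h1 : ∑ j ∈ Finset.range J, expTwoPi (j * y) =
      ∑ j ∈ Finset.range J, expTwoPi (j * (y - round y)) := by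
    refine Finset.sum_congr rfl fun j _ => ?_
    rw [expTwoPi_nat_mul, expTwoPi_nat_mul, expTwoPi_sub_intCast]
  rw [h1]
  refine le_trans ?_ (Complex.re_le_norm _)
  rw [Complex.re_sum]
  have : ∀ j ∈ Finset.range J, (1 / 2 : ℝ) ≤ (expTwoPi (j * (y - round y))).re := by
    intro j hj
    apply half_le_re_expTwoPi
    have hjJ : (j : ℝ) ≤ J := by exact_mod_cast (Finset.mem_range.1 hj).le
    rw [abs_mul, Nat.abs_cast]
    calc (j : ℝ) * |y - round y| ≤ J * δ := mul_le_mul hjJ hy (abs_nonneg _) (by positivity)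
      _ ≤ _ := hJ
  have h := Finset.card_nsmul_le_sum _ _ _ this
  simp only [Finset.card_range, nsmul_eq_mul] at h
  linarith

/-! ### Counting near-integer points by exponential sums. -/

/-- Expand the square and exchange the sums. Absolute values are taken only outside the sum over
`a`, whose cancellation is needed. -/
theorem sum_norm_sq_expTwoPi_le {α κ : Type*} (T : Finset α) (S : Finset κ) (φ : α → κ → ℝ) :
    ∑ a ∈ T, ‖∑ j ∈ S, expTwoPi (φ a j)‖ ^ 2 ≤
      ∑ j' ∈ S, ∑ j ∈ S, ‖∑ a ∈ T, expTwoPi (φ a j - φ a j')‖ := by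
  have h : ((∑ a ∈ T, ‖∑ j ∈ S, expTwoPi (φ a j)‖ ^ 2 : ℝ) : ℂ) =
      ∑ j' ∈ S, ∑ j ∈ S, ∑ a ∈ T, expTwoPi (φ a j - φ a j') := by
    push_cast
    simp_rw [← Complex.conj_mul', map_sum, conj_expTwoPi, Finset.sum_mul, Finset.mul_sum]
    rw [Finset.sum_comm]
    refine Finset.sum_congr rfl fun j' _ => ?_
    rw [Finset.sum_comm]
    refine Finset.sum_congr rfl fun j _ => Finset.sum_congr rfl fun a _ => ?_
    rw [← expTwoPi_add]; congr 1; ring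
  have hn : 0 ≤ ∑ a ∈ T, ‖∑ j ∈ S, expTwoPi (φ a j)‖ ^ 2 :=
    Finset.sum_nonneg fun _ _ => by positivity
  calc ∑ a ∈ T, ‖∑ j ∈ S, expTwoPi (φ a j)‖ ^ 2
      = ‖((∑ a ∈ T, ‖∑ j ∈ S, expTwoPi (φ a j)‖ ^ 2 : ℝ) : ℂ)‖ := by
        rw [Complex.norm_real, Real.norm_of_nonneg hn]
    _ ≤ _ := by
        rw [h]
        refine (norm_sum_le _ _).trans (Finset.sum_le_sum fun j' _ => norm_sum_le _ _)

/-- The box of integer vectors with coordinates bounded by `H`. -/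
noncomputable def intBox (l H : ℕ) : Finset (Fin l → ℤ) := Fintype.piFinset fun _ => Finset.Icc (-(H : ℤ)) H

/-- The box of vectors of natural numbers with coordinates less than `J`. -/
def natBox (m J : ℕ) : Finset (Fin m → ℕ) := Fintype.piFinset fun _ => Finset.range J

theorem card_natBox (m J : ℕ) : (natBox m J).card = J ^ m := by
  simp [natBox, Fintype.card_piFinset]

theorem card_intBox (l H : ℕ) : (intBox l H).card = (2 * H + 1) ^ l := by
  simp only [intBox, Fintype.card_piFinset, Int.card_Icc, Finset.prod_const, Finset.card_univ,
    Fintype.card_fin]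
  congr 1; omega

/-- The sum over a box factors, and the constant phase `c` has modulus 1; hence the shift `β` never
affects the count. -/
theorem norm_sum_intBox_expTwoPi {l : ℕ} (H : ℕ) (c : ℝ) (x : Fin l → ℝ) :
    ‖∑ a ∈ intBox l H, expTwoPi (c + ∑ u, (a u : ℝ) * x u)‖ =
      ∏ u, ‖∑ p ∈ Finset.Icc (-(H : ℤ)) H, expTwoPi (p * x u)‖ := by
  rw [← norm_prod, Finset.prod_univ_sum]
  simp_rw [expTwoPi_add, expTwoPi_sum]
  rw [← Finset.mul_sum, norm_mul, norm_expTwoPi, one_mul]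
  rfl

/-- The linear form of the row `u` of `M` at the integer vector `h`. -/
def rowForm {l m : ℕ} (M : Matrix (Fin l) (Fin m) ℝ) (h : Fin m → ℤ) (u : Fin l) : ℝ :=
  ∑ v, (h v : ℝ) * M u v

/-- The Fourier analytic upper bound for the number of integer vectors `a` in a box for which
`β + a M` is close to an integer vector. -/
theorem card_mul_le_sum_prod {l m : ℕ} (M : Matrix (Fin l) (Fin m) ℝ) (β : Fin m → ℝ)
    (H J : ℕ) (δ : ℝ) (hJ : J * δ ≤ 1 / 6) (T : Finset (Fin l → ℤ)) (hT : T ⊆ intBox l H)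
    (hd : ∀ a ∈ T, ∀ k, distInt (β k + ∑ u, (a u : ℝ) * M u k) ≤ δ) :
    (T.card : ℝ) * ((J : ℝ) / 2) ^ (2 * m) ≤
      ∑ j' ∈ natBox m J, ∑ j ∈ natBox m J,
        ∏ u, ‖∑ p ∈ Finset.Icc (-(H : ℤ)) H,
          expTwoPi (p * rowForm M (fun k => (j k : ℤ) - j' k) u)‖ := by
  set φ : (Fin l → ℤ) → (Fin m → ℕ) → ℝ :=
    fun a j => ∑ k, (j k : ℝ) * (β k + ∑ u, (a u : ℝ) * M u k) with hφ
  have h1 : ∀ a ∈ T, ((J : ℝ) / 2) ^ (2 * m) ≤ ‖∑ j ∈ natBox m J, expTwoPi (φ a j)‖ ^ 2 := by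
    intro a ha
    have h2 : ∑ j ∈ natBox m J, expTwoPi (φ a j) =
        ∏ k, ∑ j ∈ Finset.range J, expTwoPi (j * (β k + ∑ u, (a u : ℝ) * M u k)) := by
      rw [Finset.prod_univ_sum]
      simp_rw [hφ, expTwoPi_sum]
      rfl
    rw [h2, norm_prod, mul_comm 2 m, pow_mul]
    refine pow_le_pow_left₀ (by positivity) ?_ 2
    have h3 : ((J : ℝ) / 2) ^ m = ∏ _k : Fin m, (J : ℝ) / 2 := by
      rw [Finset.prod_const, Finset.card_univ, Fintype.card_fin]
    rw [h3]
    exact Finset.prod_le_prod (fun _ _ => by positivity)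
      fun k _ => half_mul_le_norm_sum_expTwoPi hJ (hd a ha k)
  calc (T.card : ℝ) * ((J : ℝ) / 2) ^ (2 * m)
      ≤ ∑ a ∈ T, ‖∑ j ∈ natBox m J, expTwoPi (φ a j)‖ ^ 2 := by
        have := Finset.card_nsmul_le_sum _ _ _ h1
        rwa [nsmul_eq_mul] at this
    -- Nonnegativity allows the passage from `T` to the whole box, where the sum over `a` factors.
    _ ≤ ∑ a ∈ intBox l H, ‖∑ j ∈ natBox m J, expTwoPi (φ a j)‖ ^ 2 :=
        Finset.sum_le_sum_of_subset_of_nonneg hT fun _ _ _ => by positivity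
    _ ≤ _ := sum_norm_sq_expTwoPi_le _ _ _
    _ = _ := by
        refine Finset.sum_congr rfl fun j' _ => Finset.sum_congr rfl fun j _ => ?_
        rw [← norm_sum_intBox_expTwoPi H (∑ k, ((j k : ℝ) - j' k) * β k)]
        congr 1
        refine Finset.sum_congr rfl fun a _ => ?_
        congr 1
        simp only [hφ, rowForm, Finset.mul_sum, mul_add, Finset.sum_add_distrib]
        rw [Finset.sum_comm (s := (Finset.univ : Finset (Fin l)))]
        rw [add_sub_add_comm, ← Finset.sum_sub_distrib, ← Finset.sum_sub_distrib]
        congr 1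
        · exact Finset.sum_congr rfl fun k _ => by ring
        · refine Finset.sum_congr rfl fun k _ => ?_
          rw [← Finset.sum_sub_distrib]
          refine Finset.sum_congr rfl fun u _ => ?_
          push_cast; ring

theorem rowForm_sub {l m : ℕ} (M : Matrix (Fin l) (Fin m) ℝ) (h h' : Fin m → ℤ) (u : Fin l) :
    rowForm M (fun k => h k - h' k) u = rowForm M h u - rowForm M h' u := by
  unfold rowForm
  rw [← Finset.sum_sub_distrib]
  exact Finset.sum_congr rfl fun k _ => by push_cast; ring

theorem norm_natCast_sub_natCast_le {m J : ℕ} {j j' : Fin m → ℕ} (hj : j ∈ natBox m J)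
    (hj' : j' ∈ natBox m J) : ‖fun k => (j k : ℤ) - j' k‖ ≤ J := by
  rw [pi_norm_le_iff_of_nonneg (by positivity)]
  intro k
  have h1 := Finset.mem_range.1 (Fintype.mem_piFinset.1 hj k)
  have h2 := Finset.mem_range.1 (Fintype.mem_piFinset.1 hj' k)
  rw [Int.norm_eq_abs, abs_le]
  constructor
  · have : -(J : ℤ) ≤ (j k : ℤ) - j' k := by omega
    exact_mod_cast this
  · have : (j k : ℤ) - j' k ≤ J := by omega
    exact_mod_cast this

theorem natCast_sub_natCast_ne_zero {m : ℕ} {j j' : Fin m → ℕ} (h : j ≠ j') :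
    (fun k => (j k : ℤ) - j' k) ≠ 0 := by
  intro h0
  apply h
  funext k
  have := congrFun h0 k
  simp only [Pi.zero_apply] at this
  omega

/-- The number of integer vectors `a` in a box for which `β + a M` is close to an integer vector,
in terms of a lower bound `η` for the products of the linear forms. -/
theorem exists_card_mul_le (l m : ℕ) (ε : ℝ) (hε : 0 < ε) :
    ∃ C : ℝ, 0 < C ∧ ∀ (M : Matrix (Fin (l + 1)) (Fin m) ℝ) (β : Fin m → ℝ) (H J : ℕ) (δ η : ℝ),
      0 < J → J * δ ≤ 1 / 6 → 0 < η → η ≤ 1 →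
      (∀ h : Fin m → ℤ, h ≠ 0 → ‖h‖ ≤ J → η ≤ ∏ u, distInt (rowForm M h u)) →
      ∀ T : Finset (Fin (l + 1) → ℤ), T ⊆ intBox (l + 1) H →
      (∀ a ∈ T, ∀ k, distInt (β k + ∑ u, (a u : ℝ) * M u k) ≤ δ) →
      (T.card : ℝ) * (J : ℝ) ^ m ≤
        4 ^ m * ((2 * H + 1) ^ (l + 1) + C * η⁻¹ ^ (1 + ε)) := by
  obtain ⟨C, hC, hsum⟩ := exists_sum_prod_inv_le l ε hε
  refine ⟨C, hC, ?_⟩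
  intro M β H J δ η hJ0 hJδ hη hη1 hlow T hT hd
  have hmain := card_mul_le_sum_prod M β H J δ hJδ T hT hd
  have hinner : ∀ j' ∈ natBox m J, ∑ j ∈ natBox m J,
        ∏ u, ‖∑ p ∈ Finset.Icc (-(H : ℤ)) H,
          expTwoPi (p * rowForm M (fun k => (j k : ℤ) - j' k) u)‖ ≤
        (2 * H + 1) ^ (l + 1) + C * η⁻¹ ^ (1 + ε) := by
    intro j' hj'
    -- The diagonal term `j = j'` is bounded trivially; the others use the diophantine lower bound.
    rw [← Finset.add_sum_erase _ _ hj']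
    refine add_le_add ?_ ?_
    · have h1 : ((2 * H + 1 : ℝ)) ^ (l + 1) = ∏ _u : Fin (l + 1), (2 * H + 1 : ℝ) := by simp
      rw [h1]
      refine Finset.prod_le_prod (fun _ _ => norm_nonneg _) fun u _ => ?_
      refine (norm_sum_expTwoPi_le_card _ _).trans (le_of_eq ?_)
      rw [Int.card_Icc]
      have : ((H : ℤ) + 1 - -(H : ℤ)).toNat = 2 * H + 1 := by omega
      rw [this]; push_cast; ring
    · set x : (Fin m → ℕ) → Fin (l + 1) → ℝ :=
        fun j u => rowForm M (fun k => (j k : ℤ) - j' k) u with hx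
      refine le_trans ?_ (hsum _ ((natBox m J).erase j') (fun j u => x j u - round (x j u)) η hη hη1
        ?_ ?_ ?_)
      · refine Finset.sum_le_sum fun j hj => ?_
        refine Finset.prod_le_prod (fun _ _ => norm_nonneg _) fun u _ => ?_
        obtain ⟨hne, hjm⟩ := Finset.mem_erase.1 hj
        have hp := hlow _ (natCast_sub_natCast_ne_zero hne) (norm_natCast_sub_natCast_le hjm hj')
        have hu : 0 < distInt (x j u) := by
          rcases (distInt_nonneg (x j u)).eq_or_lt with h | h
          · rw [Finset.prod_eq_zero (Finset.mem_univ u) h.symm] at hp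
            linarith
          · exact h
        have := norm_sum_expTwoPi_mul_distInt_le (-(H : ℤ)) H (x j u)
        rw [← le_div_iff₀ hu, one_div] at this
        exact this
      · intro j _ u
        exact (distInt_le_half (x j u)).trans (by norm_num)
      · intro j hj
        obtain ⟨hne, hjm⟩ := Finset.mem_erase.1 hj
        exact hlow _ (natCast_sub_natCast_ne_zero hne) (norm_natCast_sub_natCast_le hjm hj')
      -- The difference of two centred residues agrees modulo 1 with the form at `j - i`, again a
      -- nonzero vector of norm at most `J`.
      · intro j hj i hi hne
        have hjm := (Finset.mem_erase.1 hj).2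
        have him := (Finset.mem_erase.1 hi).2
        refine (hlow _ (natCast_sub_natCast_ne_zero hne)
          (norm_natCast_sub_natCast_le hjm him)).trans ?_
        refine Finset.prod_le_prod (fun _ _ => distInt_nonneg _) fun u _ => ?_
        refine (distInt_le_abs_sub_intCast _ (round (x j u) - round (x i u))).trans
          (le_of_eq ?_)
        have e : rowForm M (fun k => (j k : ℤ) - i k) u = x j u - x i u := by
          rw [hx]
          simp only
          rw [← rowForm_sub]
          congr 1
          funext k
          ring
        rw [e]; push_cast; congr 1; ring
  -- The `J^m` choices of `j'` share one bound; this factor cancels half of `J^(2m)` on the left.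
  have h2 := hmain.trans (Finset.sum_le_card_nsmul _ _ _ hinner)
  rw [card_natBox, nsmul_eq_mul] at h2
  have hJpos : (0 : ℝ) < (J : ℝ) ^ m := by positivity
  have h3 : ((J : ℝ) / 2) ^ (2 * m) = (J : ℝ) ^ m * (J : ℝ) ^ m / 4 ^ m := by
    rw [div_pow, pow_mul 2 2 m]; norm_num; ring
  rw [h3] at h2
  push_cast at h2
  set R := (2 * (H : ℝ) + 1) ^ (l + 1) + C * η⁻¹ ^ (1 + ε)
  have h4 : (J : ℝ) ^ m * ((T.card : ℝ) * (J : ℝ) ^ m) ≤ (J : ℝ) ^ m * (4 ^ m * R) := by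
    have h5 : (T.card : ℝ) * ((J : ℝ) ^ m * (J : ℝ) ^ m / 4 ^ m) * 4 ^ m ≤
        (J : ℝ) ^ m * R * 4 ^ m := by gcongr
    have h6 : (T.card : ℝ) * ((J : ℝ) ^ m * (J : ℝ) ^ m / 4 ^ m) * 4 ^ m =
        (J : ℝ) ^ m * ((T.card : ℝ) * (J : ℝ) ^ m) := by field_simp
    linarith
  exact le_of_mul_le_mul_left h4 hJpos

/-! ### From the diophantine type to the counting bound. -/

theorem Finset.exists_pos_lower_bound {α : Type*} (F : Finset α) (f : α → ℝ)
    (hf : ∀ a ∈ F, 0 < f a) : ∃ c : ℝ, 0 < c ∧ c ≤ 1 ∧ ∀ a ∈ F, c ≤ f a := by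
  classical
  induction F using Finset.induction_on with
  | empty => exact ⟨1, one_pos, le_rfl, by simp⟩
  | insert a s ha ih =>
    obtain ⟨c, hc, hc1, h⟩ := ih fun b hb => hf b (Finset.mem_insert_of_mem hb)
    refine ⟨min c (f a), lt_min hc (hf a (Finset.mem_insert_self _ _)),
      (min_le_left _ _).trans hc1, fun b hb => ?_⟩
    rcases Finset.mem_insert.1 hb with rfl | hb
    · exact min_le_right _ _
    · exact (min_le_left _ _).trans (h b hb)

theorem one_le_norm_of_ne_zero {m : ℕ} {j : Fin m → ℤ} (hj : j ≠ 0) : 1 ≤ ‖j‖ := by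
  obtain ⟨k, hk⟩ := Function.ne_iff.1 hj
  refine le_trans ?_ (norm_le_pi_norm j k)
  rw [Int.norm_eq_abs]
  exact_mod_cast Int.one_le_abs hk

theorem distInt_eq_zero_iff {y : ℝ} : distInt y = 0 ↔ ∃ z : ℤ, y = z := by
  constructor
  · intro h
    exact ⟨round y, sub_eq_zero.1 (abs_eq_zero.1 h)⟩
  · rintro ⟨z, rfl⟩
    simp [distInt]

theorem rowForm_nsmul {l m : ℕ} (M : Matrix (Fin l) (Fin m) ℝ) (k : ℕ) (h : Fin m → ℤ)
    (u : Fin l) : rowForm M (k • h) u = k * rowForm M h u := by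
  unfold rowForm
  rw [Finset.mul_sum]
  exact Finset.sum_congr rfl fun v _ => by simp [mul_assoc]

/-- A bound on the diophantine type yields a lower bound for the products of linear forms at all
nonzero integer vectors. -/
theorem exists_lower_bound_of_diophType_lt {l m : ℕ} (M : Matrix (Fin l) (Fin m) ℝ) {N : ℕ}
    (hN : 0 < N) (h : diophType M < (N : EReal)) :
    ∃ ω : ℝ, 0 < ω ∧ ω < N ∧ ∃ c : ℝ, 0 < c ∧ c ≤ 1 ∧
      ∀ j : Fin m → ℤ, j ≠ 0 → c * ‖j‖ ^ (-ω) ≤ ∏ u, distInt (rowForm M j u) := by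
  obtain ⟨ω₀, h1, h2⟩ := EReal.lt_iff_exists_real_btwn.1 h
  have hω₀ : ω₀ < N := by exact_mod_cast h2
  have hNr : (0 : ℝ) < N := by exact_mod_cast hN
  -- The type may be negative or `-∞`; the maximum keeps the exponent positive.
  set ω : ℝ := max ω₀ (N / 2) with hω
  have hωpos : 0 < ω := lt_max_of_lt_right (by positivity)
  have hωN : ω < N := max_lt hω₀ (by linarith)
  have hlt : diophType M < (ω : EReal) :=
    h1.trans_le (EReal.coe_le_coe_iff.2 (le_max_left _ _))
  set F := {j : Fin m → ℤ | ∏ u, distInt (rowForm M j u) < ‖j‖ ^ (-ω)} with hF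
  have hfin : F.Finite := by
    by_contra hinf
    exact absurd (le_sSup (Set.mem_image_of_mem (fun ω : ℝ => (ω : EReal))
      (show ω ∈ {ω : ℝ | {j : Fin m → ℤ | ∏ u, distInt (∑ v, (j v : ℝ) * M u v)
        < ‖j‖ ^ (-ω)}.Infinite} from hinf))) (not_le.2 hlt)
  -- If the product vanished at `j`, it would vanish at all positive multiples of `j`, making `F`
  -- infinite.
  have hpos : ∀ j : Fin m → ℤ, j ≠ 0 → 0 < ∏ u, distInt (rowForm M j u) := by
    intro j hj
    have hnn : 0 ≤ ∏ u, distInt (rowForm M j u) :=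
      Finset.prod_nonneg fun _ _ => distInt_nonneg _
    refine hnn.lt_of_ne fun h0 => ?_
    obtain ⟨u, _, hu⟩ := Finset.prod_eq_zero_iff.1 h0.symm
    obtain ⟨z, hz⟩ := distInt_eq_zero_iff.1 hu
    have hmem : ∀ k : ℕ, (k + 1) • j ∈ F := by
      intro k
      have hne : (k + 1) • j ≠ 0 := smul_ne_zero (by omega) hj
      have h0' : ∏ u, distInt (rowForm M ((k + 1) • j) u) = 0 := by
        refine Finset.prod_eq_zero (Finset.mem_univ u) (distInt_eq_zero_iff.2 ⟨(k + 1) * z, ?_⟩)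
        rw [rowForm_nsmul, hz]; push_cast; ring
      rw [hF, Set.mem_ofPred_eq, h0']
      have := one_le_norm_of_ne_zero hne
      positivity
    refine Set.infinite_of_injective_forall_mem (f := fun k : ℕ => (k + 1) • j) ?_ hmem hfin
    intro a b hab
    obtain ⟨v, hv⟩ := Function.ne_iff.1 hj
    have := congrFun hab v
    simp only [Pi.smul_apply, nsmul_eq_mul] at this
    have := mul_right_cancel₀ hv this
    push_cast at this
    omega
  obtain ⟨c, hc, hc1, hcF⟩ := Finset.exists_pos_lower_bound (hfin.toFinset.erase 0)
    (fun j => (∏ u, distInt (rowForm M j u)) * ‖j‖ ^ ω) (by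
      intro j hj
      have hj0 := (Finset.mem_erase.1 hj).1
      have := hpos j hj0
      have := one_le_norm_of_ne_zero hj0
      positivity)
  refine ⟨ω, hωpos, hωN, c, hc, hc1, fun j hj => ?_⟩
  have hn := one_le_norm_of_ne_zero hj
  have hnpos : 0 < ‖j‖ := by linarith
  by_cases hjF : j ∈ F
  · have := hcF j (Finset.mem_erase.2 ⟨hj, hfin.mem_toFinset.2 hjF⟩)
    rw [Real.rpow_neg hnpos.le, ← div_eq_mul_inv, div_le_iff₀ (by positivity)]
    exact this
  · have h3 : ‖j‖ ^ (-ω) ≤ ∏ u, distInt (rowForm M j u) := not_lt.1 hjF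
    exact (mul_le_of_le_one_left (by positivity) hc1).trans h3

/-- The expected upper bound for the number of integer vectors `a` in a box of side `H` for which
`β + a M` is within `δ` of an integer vector, valid for `δ` not too small in terms of `H`. -/
theorem exists_card_le {l m : ℕ} (hl : 0 < l) (M : Matrix (Fin l) (Fin m) ℝ) {ω c τ : ℝ}
    (hω : 0 < ω) (hc : 0 < c) (hc1 : c ≤ 1)
    (hlow : ∀ j : Fin m → ℤ, j ≠ 0 → c * ‖j‖ ^ (-ω) ≤ ∏ u, distInt (rowForm M j u))
    (hτ : 0 < τ) (hτω : τ * ω < l) :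
    ∃ C : ℝ, 0 < C ∧ ∀ (β : Fin m → ℝ) (H : ℕ) (δ : ℝ), 0 < H → (H : ℝ) ^ (-τ) ≤ δ →
      ∀ T : Finset (Fin l → ℤ), T ⊆ intBox l H →
      (∀ a ∈ T, ∀ k, distInt (β k + ∑ u, (a u : ℝ) * M u k) ≤ δ) →
      (T.card : ℝ) ≤ C * (H : ℝ) ^ l * δ ^ m := by
  obtain ⟨l, rfl⟩ : ∃ l', l = l' + 1 := ⟨l - 1, by omega⟩
  -- Chosen so that `τ * ω * (1 + ε) = l + 1`: the off-diagonal contribution is then of order `H^(l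
  -- + 1)`, like the diagonal one.
  set ε : ℝ := ((l + 1 : ℕ) : ℝ) / (τ * ω) - 1 with hε
  have hεpos : 0 < ε := by rw [hε, sub_pos, one_lt_div (by positivity)]; exact hτω
  obtain ⟨C, hC, hcount⟩ := exists_card_mul_le l m ε hεpos
  set K : ℝ := 4 ^ m * (3 ^ (l + 1) + C * c⁻¹ ^ (1 + ε)) with hK
  have hKpos : 0 < K := by positivity
  have hK3 : (3 : ℝ) ^ (l + 1) ≤ K := by
    rw [hK]
    have h1 : (1 : ℝ) ≤ 4 ^ m := one_le_pow₀ (by norm_num)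
    have h2 : 0 < C * c⁻¹ ^ (1 + ε) := by positivity
    nlinarith [pow_pos (by norm_num : (0 : ℝ) < 3) (l + 1)]
  refine ⟨12 ^ m * K, by positivity, ?_⟩
  intro β H δ hH hδ T hT hd
  have hHr : (1 : ℝ) ≤ H := by exact_mod_cast hH
  have hHpos : (0 : ℝ) < H := by linarith
  have hδpos : 0 < δ := lt_of_lt_of_le (by positivity) hδ
  have hbox : (2 * (H : ℝ) + 1) ^ (l + 1) ≤ 3 ^ (l + 1) * (H : ℝ) ^ (l + 1) := by
    rw [← mul_pow]
    gcongr
    linarith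
  -- For such `δ` the frequency length `J` would be 0, but the trivial bound suffices.
  by_cases hδ6 : 1 / 6 < δ
  · have h1 : (T.card : ℝ) ≤ (2 * (H : ℝ) + 1) ^ (l + 1) := by
      have := Finset.card_le_card hT
      rw [card_intBox] at this
      exact_mod_cast this
    have h2 : 1 ≤ 12 ^ m * δ ^ m := by
      rw [← mul_pow]
      exact one_le_pow₀ (by linarith)
    calc (T.card : ℝ) ≤ 3 ^ (l + 1) * (H : ℝ) ^ (l + 1) := h1.trans hbox
      _ ≤ K * (H : ℝ) ^ (l + 1) := by gcongr
      _ ≤ K * (H : ℝ) ^ (l + 1) * (12 ^ m * δ ^ m) := le_mul_of_one_le_right (by positivity) h2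
      _ = _ := by ring
  · push Not at hδ6
    set J := ⌊1 / (6 * δ)⌋₊ with hJdef
    have hX : 1 ≤ 1 / (6 * δ) := by rw [le_div_iff₀ (by positivity)]; linarith
    have hJ0 : 0 < J := Nat.floor_pos.2 hX
    have hJr : (1 : ℝ) ≤ J := by exact_mod_cast hJ0
    have hJpos : (0 : ℝ) < J := by linarith
    have hJle : (J : ℝ) ≤ 1 / (6 * δ) := Nat.floor_le (by positivity)
    have hJge : 1 / (12 * δ) ≤ J := by
      have h1 := Nat.lt_floor_add_one (1 / (6 * δ))
      rw [← hJdef] at h1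
      have h2 : 1 / (6 * δ) = 2 * (1 / (12 * δ)) := by field_simp; norm_num
      linarith
    have hJδ : J * δ ≤ 1 / 6 := by
      calc (J : ℝ) * δ ≤ 1 / (6 * δ) * δ := by gcongr
        _ = 1 / 6 := by field_simp
    have hJH : (J : ℝ) ≤ (H : ℝ) ^ τ := by
      have h1 : δ⁻¹ ≤ (H : ℝ) ^ τ := by
        rw [Real.rpow_neg hHpos.le] at hδ
        exact inv_le_of_inv_le₀ (by positivity) hδ
      refine hJle.trans (le_trans ?_ h1)
      rw [one_div]
      exact inv_anti₀ hδpos (by linarith)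
    have hη1 : c * (J : ℝ) ^ (-ω) ≤ 1 :=
      mul_le_one₀ hc1 (by positivity) (Real.rpow_le_one_of_one_le_of_nonpos hJr (by linarith))
    have h := hcount M β H J δ (c * (J : ℝ) ^ (-ω)) hJ0 hJδ (by positivity) hη1 ?_ T hT hd
    swap
    · intro h hne hle
      refine le_trans ?_ (hlow h hne)
      have hn := one_le_norm_of_ne_zero hne
      gcongr ?_ * ?_
      exact Real.rpow_le_rpow_of_nonpos (by linarith) hle (by linarith)
    have hpow : (c * (J : ℝ) ^ (-ω))⁻¹ ^ (1 + ε) ≤ c⁻¹ ^ (1 + ε) * (H : ℝ) ^ (l + 1) := by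
      rw [mul_inv, Real.mul_rpow (by positivity) (by positivity), Real.rpow_neg hJpos.le, inv_inv]
      gcongr
      calc ((J : ℝ) ^ ω) ^ (1 + ε) ≤ (((H : ℝ) ^ τ) ^ ω) ^ (1 + ε) := by gcongr
        _ = (H : ℝ) ^ (l + 1) := by
          rw [← Real.rpow_mul hHpos.le, ← Real.rpow_mul hHpos.le, ← Real.rpow_natCast]
          congr 1
          rw [hε]
          field_simp
          ring
    have h2 : (T.card : ℝ) * (J : ℝ) ^ m ≤ K * (H : ℝ) ^ (l + 1) := by
      refine h.trans ?_
      calc 4 ^ m * ((2 * (H : ℝ) + 1) ^ (l + 1) + C * (c * (J : ℝ) ^ (-ω))⁻¹ ^ (1 + ε))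
          ≤ 4 ^ m * (3 ^ (l + 1) * (H : ℝ) ^ (l + 1) +
            C * (c⁻¹ ^ (1 + ε) * (H : ℝ) ^ (l + 1))) := by gcongr
        _ = _ := by rw [hK]; ring
    have h3 : (T.card : ℝ) * (1 / (12 * δ)) ^ m ≤ K * (H : ℝ) ^ (l + 1) :=
      le_trans (by gcongr) h2
    rw [one_div, inv_pow, ← div_eq_mul_inv, div_le_iff₀ (by positivity), mul_pow] at h3
    calc (T.card : ℝ) ≤ _ := h3
      _ = _ := by ring

/-! ### The graph parametrisation and rational approximations near it. -/

theorem extMatrix_zero {d m : ℕ} (α₀ : Fin m → ℝ) (A : Matrix (Fin d) (Fin m) ℝ) (k : Fin m) :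
    extMatrix α₀ A 0 k = α₀ k := rfl

theorem extMatrix_succ {d m : ℕ} (α₀ : Fin m → ℝ) (A : Matrix (Fin d) (Fin m) ℝ) (i : Fin d)
    (k : Fin m) : extMatrix α₀ A i.succ k = A i k := rfl

theorem tendsto_natLog_two_atTop : Filter.Tendsto (Nat.log 2) Filter.atTop Filter.atTop :=
  Filter.tendsto_atTop.2 fun b => (Filter.eventually_ge_atTop (2 ^ b)).mono fun _ hq =>
    Nat.le_log_of_pow_le (by norm_num) hq

/-- The graph map parametrising `affineGraph B`. -/
noncomputable def graphMap {d m : ℕ} (B : Matrix (Fin (d + 1)) (Fin m) ℝ) (x : Fin d → ℝ) :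
    EuclideanSpace ℝ (Fin (d + m)) :=
  WithLp.toLp 2 (Fin.append x (Matrix.vecMul (Fin.cons 1 x : Fin (d + 1) → ℝ) B))

theorem graphMap_castAdd {d m : ℕ} (B : Matrix (Fin (d + 1)) (Fin m) ℝ) (x : Fin d → ℝ)
    (i : Fin d) : graphMap B x (Fin.castAdd m i) = x i := by
  simp [graphMap]

theorem graphMap_natAdd {d m : ℕ} (A : Matrix (Fin d) (Fin m) ℝ) (α₀ : Fin m → ℝ)
    (x : Fin d → ℝ) (k : Fin m) :
    graphMap (extMatrix α₀ A) x (Fin.natAdd d k) = α₀ k + ∑ i, x i * A i k := by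
  simp [graphMap, Matrix.vecMul, dotProduct, Fin.sum_univ_succ, extMatrix_zero, extMatrix_succ]

/-- The sum of the absolute values of the entries of a matrix. -/
def entrySum {d m : ℕ} (A : Matrix (Fin d) (Fin m) ℝ) : ℝ := ∑ k, ∑ i, |A i k|

theorem entrySum_nonneg {d m : ℕ} (A : Matrix (Fin d) (Fin m) ℝ) : 0 ≤ entrySum A :=
  Finset.sum_nonneg fun _ _ => Finset.sum_nonneg fun _ _ => abs_nonneg _

theorem abs_sum_mul_le {d m : ℕ} (A : Matrix (Fin d) (Fin m) ℝ) (z : Fin d → ℝ) {r : ℝ}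
    (hr : 0 ≤ r) (hz : ∀ i, |z i| ≤ r) (k : Fin m) : |∑ i, z i * A i k| ≤ entrySum A * r := by
  calc |∑ i, z i * A i k| ≤ ∑ i, |z i * A i k| := Finset.abs_sum_le_sum_abs _ _
    _ ≤ ∑ i, |A i k| * r := Finset.sum_le_sum fun i _ => by
        rw [abs_mul, mul_comm]; exact mul_le_mul_of_nonneg_left (hz i) (abs_nonneg _)
    _ = (∑ i, |A i k|) * r := (Finset.sum_mul _ _ _).symm
    _ ≤ entrySum A * r := by
        gcongr
        exact Finset.single_le_sum (f := fun k => ∑ i, |A i k|)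
          (fun _ _ => Finset.sum_nonneg fun _ _ => abs_nonneg _) (Finset.mem_univ k)

theorem exists_lipschitzWith_graphMap {d m : ℕ} (A : Matrix (Fin d) (Fin m) ℝ) (α₀ : Fin m → ℝ) :
    ∃ K : ℝ≥0, LipschitzWith K (graphMap (extMatrix α₀ A)) := by
  have hK : 0 ≤ entrySum A := entrySum_nonneg A
  have h : LipschitzWith (1 + (entrySum A).toNNReal) fun x : Fin d → ℝ =>
      Fin.append x (Matrix.vecMul (Fin.cons 1 x : Fin (d + 1) → ℝ) (extMatrix α₀ A)) := by
    refine LipschitzWith.of_dist_le_mul fun x y => ?_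
    have hd : ∀ i, |x i - y i| ≤ dist x y := fun i => dist_le_pi_dist x y i
    rw [dist_pi_le_iff (by positivity)]
    push_cast
    rw [Real.coe_toNNReal _ hK]
    intro b
    refine Fin.addCases (fun i => ?_) (fun k => ?_) b
    · have e : ∀ x, Fin.append x (Matrix.vecMul (Fin.cons 1 x : Fin (d + 1) → ℝ)
          (extMatrix α₀ A)) (Fin.castAdd m i) = x i := fun x => graphMap_castAdd _ x i
      rw [e, e, Real.dist_eq]
      exact (hd i).trans (le_mul_of_one_le_left dist_nonneg (by linarith))
    · have e : ∀ x, Fin.append x (Matrix.vecMul (Fin.cons 1 x : Fin (d + 1) → ℝ)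
          (extMatrix α₀ A)) (Fin.natAdd d k) = α₀ k + ∑ i, x i * A i k :=
        fun x => graphMap_natAdd A α₀ x k
      rw [e, e, Real.dist_eq, add_sub_add_left_eq_sub, ← Finset.sum_sub_distrib]
      simp_rw [← sub_mul]
      refine (abs_sum_mul_le A (fun i => x i - y i) dist_nonneg hd k).trans ?_
      gcongr
      linarith
  exact ⟨_, (PiLp.lipschitzWith_toLp 2 _).comp h⟩

/-- A subset of an affine subspace is null if its preimages in all boxes are. -/
theorem euclideanHausdorffMeasure_affineGraph_inter_eq_zero {d m : ℕ}
    (A : Matrix (Fin d) (Fin m) ℝ) (α₀ : Fin m → ℝ) (S : Set (EuclideanSpace ℝ (Fin (d + m))))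
    (h : ∀ R : ℕ, volume {x : Fin d → ℝ | ‖x‖ ≤ R ∧ graphMap (extMatrix α₀ A) x ∈ S} = 0) :
    (μHE[d] : Measure (EuclideanSpace ℝ (Fin (d + m)))) (affineGraph (extMatrix α₀ A) ∩ S) = 0 := by
  obtain ⟨K, hK⟩ := exists_lipschitzWith_graphMap A α₀
  have hnull : volume {x : Fin d → ℝ | graphMap (extMatrix α₀ A) x ∈ S} = 0 := by
    refine measure_mono_null (t := ⋃ R : ℕ,
      {x : Fin d → ℝ | ‖x‖ ≤ R ∧ graphMap (extMatrix α₀ A) x ∈ S}) ?_ (measure_iUnion_null h)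
    intro x hx
    obtain ⟨R, hR⟩ := exists_nat_ge ‖x‖
    exact Set.mem_iUnion.2 ⟨R, hR, hx⟩
  have hH : (μH[(d : ℝ)] : Measure (EuclideanSpace ℝ (Fin (d + m))))
      (affineGraph (extMatrix α₀ A) ∩ S) = 0 := by
    refine measure_mono_null (t := graphMap (extMatrix α₀ A) ''
      {x : Fin d → ℝ | graphMap (extMatrix α₀ A) x ∈ S}) ?_ ?_
    · rintro _ ⟨⟨x, rfl⟩, hx⟩
      exact ⟨x, hx, rfl⟩
    · refine le_antisymm ((hK.hausdorffMeasure_image_le (Nat.cast_nonneg d) _).trans ?_) bot_le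
      have : (μH[(d : ℝ)] : Measure (Fin d → ℝ)) = volume := by
        simpa using hausdorffMeasure_pi_real (ι := Fin d)
      rw [this, hnull, mul_zero]
  -- The normalised measure is a scalar multiple of `μH[d]`, so null sets agree.
  rw [Measure.euclideanHausdorffMeasure_def, Measure.smul_apply, hH, smul_zero]

/-- Points of the affine subspace that are close to a rational point with denominator `q` lie
over a neighbourhood of a rational point that is itself close to the subspace. -/
theorem exists_int_approx {d m : ℕ} (A : Matrix (Fin d) (Fin m) ℝ) (α₀ : Fin m → ℝ) {R q : ℕ}
    (hq : 0 < q) {x : Fin d → ℝ} (hx : ‖x‖ ≤ R) {r : ℝ}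
    (h : distIntVec (fun k => (q : ℝ) * graphMap (extMatrix α₀ A) x k) < r) :
    ∃ p : Fin d → ℤ, (∀ i, |x i - p i / q| ≤ r / q) ∧
      (∀ i, -((q * (R + 1) : ℕ) : ℤ) ≤ p i ∧ p i ≤ (q * (R + 1) : ℕ)) ∧
      ∀ k, distInt (q * α₀ k + ∑ i, (p i : ℝ) * A i k) ≤ (1 + entrySum A) * r := by
  have hqr : (1 : ℝ) ≤ q := by exact_mod_cast hq
  have hqpos : (0 : ℝ) < q := by linarith
  have hr : 0 ≤ r := (norm_nonneg _).trans h.le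
  have hc : ∀ k, distInt ((q : ℝ) * graphMap (extMatrix α₀ A) x k) ≤ r := fun k =>
    (le_abs_self _).trans ((norm_le_pi_norm
      (fun k => distInt ((q : ℝ) * graphMap (extMatrix α₀ A) x k)) k).trans h.le)
  have hp : ∀ i, |q * x i - round (q * x i)| ≤ r := fun i => by
    have := hc (Fin.castAdd m i)
    rwa [graphMap_castAdd] at this
  refine ⟨fun i => round (q * x i), fun i => ?_, fun i => ?_, fun k => ?_⟩
  · have e : x i - round (q * x i) / q = (q * x i - round (q * x i)) / q := by
      field_simp
    rw [e, abs_div, abs_of_pos hqpos]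
    gcongr
    exact hp i
  · have h1 := abs_le.1 (abs_sub_round (q * x i))
    have h2 := abs_le.1 ((norm_le_pi_norm x i).trans hx)
    have h3 : |(q : ℝ) * x i| ≤ q * R := by
      rw [abs_mul, Nat.abs_cast]
      gcongr
      exact abs_le.2 h2
    have h4 := abs_le.1 h3
    constructor
    · have : -((q * (R + 1) : ℕ) : ℝ) ≤ round (q * x i) := by push_cast; linarith
      exact_mod_cast this
    · have : (round (q * x i) : ℝ) ≤ (q * (R + 1) : ℕ) := by push_cast; linarith
      exact_mod_cast this
  · have h1 := hc (Fin.natAdd d k)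
    rw [graphMap_natAdd] at h1
    -- Moving from `q * x` to its rounding changes each dependent coordinate by at most `entrySum A
    -- * r`.
    have h2 := distInt_le_distInt_add (q * α₀ k + ∑ i, (round (q * x i) : ℝ) * A i k)
      (q * (α₀ k + ∑ i, x i * A i k))
    have h3 := abs_sum_mul_le A (fun i => round (q * x i) - q * x i) hr
      (fun i => by rw [abs_sub_comm]; exact hp i) k
    have e : (q * α₀ k + ∑ i, (round (q * x i) : ℝ) * A i k) - q * (α₀ k + ∑ i, x i * A i k) =
        ∑ i, (round (q * x i) - q * x i) * A i k := by
      rw [mul_add, Finset.mul_sum, add_sub_add_left_eq_sub, ← Finset.sum_sub_distrib]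
      exact Finset.sum_congr rfl fun i _ => by ring
    rw [e] at h2
    linarith

/-! ### Borel–Cantelli, with and without monotonicity. -/

theorem volume_biUnion_closedBall_le {d : ℕ} {α : Type*} (T : Finset α) (z : α → Fin d → ℝ)
    {r : ℝ} (hr : 0 ≤ r) :
    volume (⋃ a ∈ T, Metric.closedBall (z a) r) ≤ ENNReal.ofReal (T.card * (2 * r) ^ d) := by
  refine (measure_biUnion_finset_le _ _).trans ?_
  simp_rw [Real.volume_pi_closedBall _ hr, Fintype.card_fin]
  rw [Finset.sum_const, nsmul_eq_mul, ENNReal.ofReal_mul (by positivity), ENNReal.ofReal_natCast]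

theorem summable_max_rpow_pow {n : ℕ} {ψ : ℕ → ℝ} {τ : ℝ} (hψ : ∀ q, 0 ≤ ψ q)
    (hsum : Summable fun q => ψ q ^ n) (hτ : 1 < τ * n) :
    Summable fun q : ℕ => max (ψ q) ((q : ℝ) ^ (-τ)) ^ n := by
  have h2 : Summable fun q : ℕ => ((q : ℝ) ^ (-τ)) ^ n := by
    have : Summable fun q : ℕ => (q : ℝ) ^ (-(τ * n)) := Real.summable_nat_rpow.2 (by linarith)
    refine this.congr fun q => ?_
    rw [← Real.rpow_natCast, ← Real.rpow_mul (Nat.cast_nonneg q), neg_mul]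
  refine Summable.of_nonneg_of_le (fun q => by have := hψ q; positivity) (fun q => ?_)
    (hsum.add h2)
  rcases max_cases (ψ q) ((q : ℝ) ^ (-τ)) with h | h
  · rw [h.1]; exact le_add_of_nonneg_right (by positivity)
  · rw [h.1]; exact le_add_of_nonneg_left (pow_nonneg (hψ q) n)

/-- The requirements amount to `1/n < τ < l/ω`; this is where the bound on the diophantine type
enters. -/
theorem exists_exponent {l n : ℕ} {ω : ℝ} (hn : 0 < n) (hω : 0 < ω)
    (hlt : ω < (l * n : ℕ)) : ∃ τ : ℝ, 0 < τ ∧ 1 < τ * n ∧ τ * ω < l := by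
  have hnr : (0 : ℝ) < n := by exact_mod_cast hn
  push_cast at hlt
  obtain ⟨τ, h1, h2⟩ := exists_between (show (1 : ℝ) / n < l / ω by
    rw [div_lt_div_iff₀ hnr hω]; linarith)
  exact ⟨τ, lt_trans (by positivity) h1, (div_lt_iff₀ hnr).1 h1, (lt_div_iff₀ hω).1 h2⟩

theorem distInt_rpow_neg_le {Q H : ℕ} {τ K r : ℝ} (hQ : 0 < Q) (hQH : Q ≤ H) (hτ : 0 < τ)
    (hK : 0 ≤ K) (hr : (Q : ℝ) ^ (-τ) ≤ r) : (H : ℝ) ^ (-τ) ≤ (1 + K) * r := by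
  have hQr : (0 : ℝ) < Q := by exact_mod_cast hQ
  have h1 : (H : ℝ) ^ (-τ) ≤ (Q : ℝ) ^ (-τ) :=
    Real.rpow_le_rpow_of_nonpos hQr (by exact_mod_cast hQH) (by linarith)
  have h2 : 0 ≤ r := le_trans (by positivity) hr
  exact (h1.trans hr).trans (le_mul_of_one_le_left h2 (by linarith))

/-- For fixed `q`, about `q^d * φ(q)^m` balls of radius `φ(q)/q` cover the event, so its volume is
at most a constant times `φ(q)^(d + m)`. -/
theorem volume_frequently_eq_zero {d m : ℕ} (hd : 0 < d)
    (A : Matrix (Fin d) (Fin m) ℝ) (α₀ : Fin m → ℝ)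
    (hA : diophType A < ((d * (d + m) : ℕ) : EReal)) (ψ : ℕ → ℝ) (hψ : ∀ q, 0 ≤ ψ q)
    (hsum : Summable fun q => ψ q ^ (d + m)) (R : ℕ) :
    volume {x : Fin d → ℝ | ∃ᶠ q : ℕ in Filter.atTop, ‖x‖ ≤ R ∧ 0 < q ∧
      distIntVec (fun k => (q : ℝ) * graphMap (extMatrix α₀ A) x k) < ψ q} = 0 := by
  classical
  obtain ⟨ω, hω, hωlt, c, hc, hc1, hlow⟩ :=
    exists_lower_bound_of_diophType_lt A (by positivity) hA
  obtain ⟨τ, hτ, hτn, hτω⟩ := exists_exponent (by omega) hω hωlt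
  obtain ⟨C, hC, hcard⟩ := exists_card_le hd A hω hc hc1 hlow hτ hτω
  have hK := entrySum_nonneg A
  set K := entrySum A with hKdef
  set φ : ℕ → ℝ := fun q => max (ψ q) ((q : ℝ) ^ (-τ)) with hφ
  have hφ0 : ∀ q, 0 ≤ φ q := fun q => (hψ q).trans (le_max_left _ _)
  set D : ℝ := C * (R + 1) ^ d * (1 + K) ^ m * 2 ^ d with hD
  have hsumφ : Summable fun q => D * φ q ^ (d + m) :=
    (summable_max_rpow_pow hψ hsum hτn).mul_left D
  refine measure_setOfPred_frequently_eq_zero ?_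
  refine ne_top_of_le_ne_top hsumφ.tsum_ofReal_ne_top (ENNReal.tsum_le_tsum fun q => ?_)
  rcases Nat.eq_zero_or_pos q with rfl | hq
  · simp
  have hqpos : (0 : ℝ) < q := by exact_mod_cast hq
  set T := (intBox d (q * (R + 1))).filter fun p =>
    ∀ k, distInt (q * α₀ k + ∑ i, (p i : ℝ) * A i k) ≤ (1 + K) * φ q with hT
  have hcov : {x : Fin d → ℝ | ‖x‖ ≤ R ∧ 0 < q ∧
      distIntVec (fun k => (q : ℝ) * graphMap (extMatrix α₀ A) x k) < ψ q} ⊆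
      ⋃ p ∈ T, Metric.closedBall (fun i => (p i : ℝ) / q) (φ q / q) := by
    rintro x ⟨hx, _, hxq⟩
    obtain ⟨p, h1, h2, h3⟩ := exists_int_approx A α₀ hq hx (hxq.trans_le (le_max_left _ _))
    refine Set.mem_iUnion₂.2 ⟨p, Finset.mem_filter.2 ⟨?_, h3⟩, ?_⟩
    · exact Fintype.mem_piFinset.2 fun i => Finset.mem_Icc.2 (h2 i)
    · rw [Metric.mem_closedBall, dist_pi_le_iff (div_nonneg (hφ0 q) hqpos.le)]
      exact h1
  refine (measure_mono hcov).trans ((volume_biUnion_closedBall_le _ _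
    (div_nonneg (hφ0 q) hqpos.le)).trans (ENNReal.ofReal_le_ofReal ?_))
  have h := hcard (fun k => q * α₀ k) (q * (R + 1)) ((1 + K) * φ q) (by positivity)
    (distInt_rpow_neg_le hq (Nat.le_mul_of_pos_right q (by omega)) hτ hK (le_max_right _ _))
    T (Finset.filter_subset _ _) fun p hp => (Finset.mem_filter.1 hp).2
  have hφq := hφ0 q
  calc (T.card : ℝ) * (2 * (φ q / q)) ^ d
      ≤ C * ((q * (R + 1) : ℕ) : ℝ) ^ d * ((1 + K) * φ q) ^ m * (2 * (φ q / q)) ^ d := by gcongr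
    _ = D * φ q ^ (d + m) := by
      rw [hD]
      push_cast
      simp only [mul_pow, div_pow, pow_add]
      field_simp

/-- With `q` an extra integer variable, a block `2^i ≤ q < 2^(i+1)` has volume at most a constant
times `2^i * φ(2^i)^(d + m)`. Monotonicity gives one radius per block and Cauchy condensation. -/
theorem volume_frequently_eq_zero_of_antitone {d m : ℕ} (hd : 0 < d)
    (A : Matrix (Fin d) (Fin m) ℝ) (α₀ : Fin m → ℝ)
    (hA : diophType (extMatrix α₀ A) < (((d + 1) * (d + m) : ℕ) : EReal)) (ψ : ℕ → ℝ)
    (hψ : ∀ q, 0 ≤ ψ q) (hanti : ∀ q q', 0 < q → q ≤ q' → ψ q' ≤ ψ q)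
    (hsum : Summable fun q => ψ q ^ (d + m)) (R : ℕ) :
    volume {x : Fin d → ℝ | ∃ᶠ q : ℕ in Filter.atTop, ‖x‖ ≤ R ∧ 0 < q ∧
      distIntVec (fun k => (q : ℝ) * graphMap (extMatrix α₀ A) x k) < ψ q} = 0 := by
  classical
  obtain ⟨ω, hω, hωlt, c, hc, hc1, hlow⟩ :=
    exists_lower_bound_of_diophType_lt (extMatrix α₀ A) (by positivity) hA
  obtain ⟨τ, hτ, hτn, hτω⟩ := exists_exponent (by omega) hω hωlt
  obtain ⟨C, hC, hcard⟩ :=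
    exists_card_le (Nat.succ_pos d) (extMatrix α₀ A) hω hc hc1 hlow hτ hτω
  have hK := entrySum_nonneg A
  set K := entrySum A with hKdef
  set φ : ℕ → ℝ := fun q => max (ψ q) ((q : ℝ) ^ (-τ)) with hφ
  have hφ0 : ∀ q, 0 ≤ φ q := fun q => (hψ q).trans (le_max_left _ _)
  have hφanti : ∀ q q', 0 < q → q ≤ q' → φ q' ≤ φ q := fun q q' hq hqq' =>
    max_le_max (hanti q q' hq hqq') (Real.rpow_le_rpow_of_nonpos (by exact_mod_cast hq)
      (by exact_mod_cast hqq') (by linarith))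
  set D : ℝ := C * (2 * (R + 1)) ^ (d + 1) * (1 + K) ^ m * 2 ^ d with hD
  have hsumφ : Summable fun i : ℕ => D * (2 ^ i * φ (2 ^ i) ^ (d + m)) := by
    refine Summable.mul_left D ?_
    refine (summable_condensed_iff_of_nonneg (f := fun q => φ q ^ (d + m))
      (fun q => pow_nonneg (hφ0 q) _) fun q q' hq hqq' => ?_).2
      (summable_max_rpow_pow hψ hsum hτn)
    exact pow_le_pow_left₀ (hφ0 _) (hφanti q q' hq hqq') _
  set P : ℕ → (Fin d → ℝ) → Prop := fun i x => ‖x‖ ≤ R ∧ ∃ q : ℕ, 2 ^ i ≤ q ∧ q < 2 ^ (i + 1) ∧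
    distIntVec (fun k => (q : ℝ) * graphMap (extMatrix α₀ A) x k) < φ (2 ^ i) with hP
  have hblock : volume {x | ∃ᶠ i in Filter.atTop, P i x} = 0 := by
    refine measure_setOfPred_frequently_eq_zero ?_
    refine ne_top_of_le_ne_top hsumφ.tsum_ofReal_ne_top (ENNReal.tsum_le_tsum fun i => ?_)
    set H := 2 ^ (i + 1) * (R + 1) with hH
    have hφi := hφ0 (2 ^ i)
    set T := (intBox (d + 1) H).filter fun a =>
      ∀ k, distInt (0 + ∑ u, (a u : ℝ) * extMatrix α₀ A u k) ≤ (1 + K) * φ (2 ^ i) with hT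
    have hcov : {x : Fin d → ℝ | P i x} ⊆
        ⋃ a ∈ T, Metric.closedBall (fun j => (a j.succ : ℝ) / a 0) (φ (2 ^ i) / 2 ^ i) := by
      rintro x ⟨hx, q, hq1, hq2, hxq⟩
      have hq : 0 < q := lt_of_lt_of_le (by positivity) hq1
      have hqH : q * (R + 1) ≤ H := Nat.mul_le_mul_right _ hq2.le
      have hqH' : q ≤ H := (Nat.le_mul_of_pos_right q (by omega)).trans hqH
      obtain ⟨p, h1, h2, h3⟩ := exists_int_approx A α₀ hq hx hxq
      refine Set.mem_iUnion₂.2 ⟨Fin.cons (q : ℤ) p, Finset.mem_filter.2 ⟨?_, fun k => ?_⟩, ?_⟩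
      · refine Fintype.mem_piFinset.2 fun u => Finset.mem_Icc.2 ?_
        refine Fin.cases ?_ (fun j => ?_) u
        · simp only [Fin.cons_zero]; omega
        · have := h2 j
          simp only [Fin.cons_succ]; omega
      · rw [Fin.sum_univ_succ]
        simpa [extMatrix_zero, extMatrix_succ] using h3 k
      · rw [Metric.mem_closedBall, dist_pi_le_iff (by positivity)]
        intro j
        simp only [Fin.cons_succ, Fin.cons_zero, Int.cast_natCast]
        refine (h1 j).trans ?_
        gcongr
        exact_mod_cast hq1
    refine (measure_mono hcov).trans ((volume_biUnion_closedBall_le _ _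
      (by positivity)).trans (ENNReal.ofReal_le_ofReal ?_))
    have h := hcard (fun _ => 0) H ((1 + K) * φ (2 ^ i)) (by positivity)
      (distInt_rpow_neg_le (Q := 2 ^ i) (by positivity)
        ((Nat.pow_le_pow_right (by norm_num) (Nat.le_succ i)).trans
          (Nat.le_mul_of_pos_right _ (by omega))) hτ hK (le_max_right _ _))
      T (Finset.filter_subset _ _) fun a ha => (Finset.mem_filter.1 ha).2
    calc (T.card : ℝ) * (2 * (φ (2 ^ i) / 2 ^ i)) ^ d
        ≤ C * (H : ℝ) ^ (d + 1) * ((1 + K) * φ (2 ^ i)) ^ m * (2 * (φ (2 ^ i) / 2 ^ i)) ^ d := by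
          gcongr
      _ = D * (2 ^ i * φ (2 ^ i) ^ (d + m)) := by
        rw [hD, hH]
        push_cast
        rw [pow_succ (2 : ℝ) i, show (2 : ℝ) ^ i * 2 * (R + 1) = 2 ^ i * (2 * (R + 1)) by ring,
          mul_pow ((2 : ℝ) ^ i), pow_succ ((2 : ℝ) ^ i) d, mul_pow 2 (φ (2 ^ i) / 2 ^ i),
          div_pow, mul_pow (1 + K), pow_add (φ (2 ^ i))]
        field_simp
  refine measure_mono_null (fun x hx => ?_) hblock
  refine Filter.Tendsto.frequently (f := Nat.log 2) tendsto_natLog_two_atTop ?_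
  refine Filter.Frequently.mono hx fun q hq => ?_
  obtain ⟨hxR, hq0, hxq⟩ := hq
  have hlog := Nat.pow_log_le_self 2 hq0.ne'
  exact ⟨hxR, q, hlog, Nat.lt_pow_succ_log_self (by norm_num) q,
    hxq.trans_le ((le_max_left _ _).trans (hφanti _ _ (by positivity) hlog))⟩

/-! ### Passage from `ℕ+` to `ℕ` and conclusion. -/

/-- `toPNat'` sends 0 to 1, so the extension of `ψ` has an arbitrary value at 0; the condition `0 <
q` discards it. -/
theorem frequently_of_mem_simulApprox {n : ℕ} {ψ : ℕ+ → ℝ≥0} {x : EuclideanSpace ℝ (Fin n)}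
    (hx : x ∈ simulApprox n ψ) : ∃ᶠ q : ℕ in Filter.atTop, 0 < q ∧
      distIntVec (fun k => (q : ℝ) * x k) < ψ q.toPNat' := by
  rw [Nat.frequently_atTop_iff_infinite]
  refine Set.Infinite.mono ?_ (Set.Infinite.image (f := fun q : ℕ+ => (q : ℕ))
    PNat.coe_injective.injOn hx)
  rintro _ ⟨q, hq, rfl⟩
  refine ⟨q.pos, ?_⟩
  simpa using hq

theorem summable_toPNat' {n : ℕ} {ψ : ℕ+ → ℝ≥0} (h : Summable fun q : ℕ+ => ψ q ^ n) :
    Summable fun q : ℕ => (ψ q.toPNat' : ℝ) ^ n := by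
  rw [← summable_pnat_iff_summable_nat]
  simpa [← NNReal.coe_pow] using NNReal.summable_coe.2 h

theorem theorem1p1 (d m : ℕ) (hd : 0 < d) (hm : 0 < m)
    (A : Matrix (Fin d) (Fin m) ℝ) (α₀ : Fin m → ℝ) :
    (diophType A < ((d * (d + m) : ℕ) : EReal) →
      IsStrongKhintchineTypeConv d (affineGraph (extMatrix α₀ A))) ∧
    (diophType (extMatrix α₀ A) < (((d + 1) * (d + m) : ℕ) : EReal) →
      IsKhintchineTypeConv d (affineGraph (extMatrix α₀ A))) := by
  refine ⟨fun hA ψ hsum => ?_, fun hA ψ hanti hsum => ?_⟩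
  · refine euclideanHausdorffMeasure_affineGraph_inter_eq_zero A α₀ _ fun R => ?_
    refine measure_mono_null (fun x hx => ?_) (volume_frequently_eq_zero hd A α₀ hA
      (fun q => ψ q.toPNat') (fun q => NNReal.coe_nonneg _) (summable_toPNat' hsum) R)
    exact (frequently_of_mem_simulApprox hx.2).mono fun q hq => ⟨hx.1, hq⟩
  · refine euclideanHausdorffMeasure_affineGraph_inter_eq_zero A α₀ _ fun R => ?_
    refine measure_mono_null (fun x hx => ?_) (volume_frequently_eq_zero_of_antitone hd A α₀ hA
      (fun q => ψ q.toPNat') (fun q => NNReal.coe_nonneg _) (fun q q' hq hqq' => ?_)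
      (summable_toPNat' hsum) R)
    · exact (frequently_of_mem_simulApprox hx.2).mono fun q hq => ⟨hx.1, hq⟩
    · refine NNReal.coe_le_coe.2 (hanti ?_)
      rw [← PNat.coe_le_coe, Nat.toPNat'_coe, Nat.toPNat'_coe, if_pos hq,
        if_pos (hq.trans_le hqq')]
      exact hqq'
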